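/- Let $0<r\le 1$. For every $n$, let $\|\cdot\|$ be the Euclidean norm on $\mathbb{R}^n$ and let $$f(x)=\frac{1-\|x\|}{1-\|x\|^r},\qquad g(x)=\frac{1-\|x\|^r}{1-\|x\|}\qquad(x\in\mathbb{R}^n),$$ interpreted as the limiting values $1/r$ and $r$, respectively, when $\|x\|=1$. Then: 1. $f$ is conditionally negative definite: $f$ is continuous and, for every $m$ and all $x_1,\dots,x_m\in\mathbb{R}^n$, the matrix $[f(x_i-x_j)]_{i,j}$ is symmetric and $\sum_{i,j}f(x_i-x_j)\,v_iv_j\le 0$ for all $v\in\mathbb{R}^m$ with $\sum_i v_i=0$. 2. As a consequence, its reciprocal $g=1/f$ is infinitely divisible: $g$ is continuous and nonnegative and, for every $\alpha\ge 0$, every $m$ and all $x_1,\dots,x_m\in\mathbb{R}^n$, the matrix $[g(x_i-x_j)^{\alpha}]_{i,j}$ is (symmetric) positive semidefinite. -/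

import Mathlib

/-- A real square matrix is conditionally positive definite if it is symmetric and `⟨v, A v⟩ ≥ 0`
for every vector `v` whose coordinates sum to `0`. -/
def Matrix.IsCondPosDef {m : ℕ} (A : Matrix (Fin m) (Fin m) ℝ) : Prop :=
  A.IsSymm ∧ ∀ v : Fin m → ℝ, ∑ i, v i = 0 → 0 ≤ v ⬝ᵥ A.mulVec v

/-- A real square matrix `A` is conditionally negative definite if `-A` is conditionally positive
definite. -/
def Matrix.IsCondNegDef {m : ℕ} (A : Matrix (Fin m) (Fin m) ℝ) : Prop :=
  (-A).IsCondPosDef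

/-- The Hadamard (entrywise) power of a real matrix. -/
noncomputable def Matrix.hadamardPow {m : ℕ} (A : Matrix (Fin m) (Fin m) ℝ) (α : ℝ) :
    Matrix (Fin m) (Fin m) ℝ :=
  Matrix.of fun i j => A i j ^ α

/-- A real square matrix with nonnegative entries is infinitely divisible if all its Hadamard
powers with nonnegative exponent are positive semidefinite. -/
def Matrix.IsInfDivisible {m : ℕ} (A : Matrix (Fin m) (Fin m) ℝ) : Prop :=
  (∀ i j, 0 ≤ A i j) ∧ ∀ α : ℝ, 0 ≤ α → (A.hadamardPow α).PosSemidef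

/-- The matrix `[f (x_i - x_j)]` of a function at a finite family of points. -/
def diffMatrix {E : Type*} [AddGroup E] (f : E → ℝ) {m : ℕ} (x : Fin m → E) :
    Matrix (Fin m) (Fin m) ℝ :=
  Matrix.of fun i j => f (x i - x j)

/-- A continuous function `f` is conditionally negative definite if all the matrices
`[f (x_i - x_j)]` are. -/
def IsCondNegDefFun {E : Type*} [AddGroup E] [TopologicalSpace E] (f : E → ℝ) : Prop :=
  Continuous f ∧ ∀ (m : ℕ) (x : Fin m → E), (diffMatrix f x).IsCondNegDef

/-- A continuous function `f` is infinitely divisible if all the matrices `[f (x_i - x_j)]` are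
(this includes that `f` is nonnegative). -/
def IsInfDivisibleFun {E : Type*} [AddGroup E] [TopologicalSpace E] (f : E → ℝ) : Prop :=
  Continuous f ∧ ∀ (m : ℕ) (x : Fin m → E), (diffMatrix f x).IsInfDivisible

/-- The function `x ↦ (1 - ‖x‖) / (1 - ‖x‖ ^ r)`, with the limiting value `1 / r` at `‖x‖ = 1`. -/
noncomputable def normQuot {E : Type*} [Norm E] (r : ℝ) (x : E) : ℝ :=
  open Classical in if ‖x‖ = 1 then 1 / r else (1 - ‖x‖) / (1 - ‖x‖ ^ r)

/-- The function `x ↦ (1 - ‖x‖ ^ r) / (1 - ‖x‖)`, with the limiting value `r` at `‖x‖ = 1`. -/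
noncomputable def normQuotRecip {E : Type*} [Norm E] (r : ℝ) (x : E) : ℝ :=
  open Classical in if ‖x‖ = 1 then r else (1 - ‖x‖ ^ r) / (1 - ‖x‖)

open Filter Topology

/-! ### Quadratic forms, Schur products and Schoenberg's theorem -/

namespace Matrix

variable {m : ℕ} {A B : Matrix (Fin m) (Fin m) ℝ}

/-! With `t = ‖x‖`, the quotient is `1/r` times the integral over `s ∈ [0,1]` of `(1 - s + s
t^r)^(1/r - 1)` (`integral_one_sub_add_mul_rpow`), so it suffices to treat each integrand. Let `A`
be conditionally negative definite with nonnegative entries. `H(A)` is again so when `H' → 0` at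
infinity and `H'(A + τ)` is positive semidefinite for `τ > 0` (`isCondNegDef_of_posSemidef_deriv`).
For these integrands `H'` factors into pieces whose positivity follows from Schur products and
negative powers (`posSemidef_rpow_neg`, from Schoenberg's theorem and the Gamma integral). The
distance matrix is such an `A`, and infinite divisibility of the reciprocal is `posSemidef_rpow_neg`
once more. -/

theorem dotProduct_mulVec_eq_sum (A : Matrix (Fin m) (Fin m) ℝ) (v : Fin m → ℝ) :
    v ⬝ᵥ A.mulVec v = ∑ i, ∑ j, v i * A i j * v j := by
  simp only [dotProduct, mulVec, Finset.mul_sum, mul_assoc]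

theorem posSemidef_iff_sum_nonneg :
    A.PosSemidef ↔ A.IsSymm ∧ ∀ v : Fin m → ℝ, 0 ≤ ∑ i, ∑ j, v i * A i j * v j := by
  rw [posSemidef_iff_dotProduct_mulVec]
  simp [← dotProduct_mulVec_eq_sum, IsHermitian, IsSymm]

theorem isCondNegDef_iff_sum_nonpos :
    A.IsCondNegDef ↔ A.IsSymm ∧
      ∀ v : Fin m → ℝ, ∑ i, v i = 0 → ∑ i, ∑ j, v i * A i j * v j ≤ 0 := by
  simp only [IsCondNegDef, IsCondPosDef, dotProduct_mulVec_eq_sum]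
  simp [IsSymm]

theorem sum_mul_const_mul (c : ℝ) (v : Fin m → ℝ) :
    ∑ i, ∑ j, v i * c * v j = c * (∑ i, v i) ^ 2 := by
  rw [sq, Finset.sum_mul_sum, Finset.mul_sum]
  refine Finset.sum_congr rfl fun i _ => ?_
  rw [Finset.mul_sum]
  exact Finset.sum_congr rfl fun j _ => by ring

theorem posSemidef_of_const {c : ℝ} (hc : 0 ≤ c) :
    (of fun _ _ : Fin m => c).PosSemidef := by
  refine posSemidef_iff_sum_nonneg.2 ⟨by ext; simp, fun v => ?_⟩
  simp only [of_apply, sum_mul_const_mul]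
  positivity

theorem isCondNegDef_of_const (c : ℝ) : (of fun _ _ : Fin m => c).IsCondNegDef := by
  refine isCondNegDef_iff_sum_nonpos.2 ⟨by ext; simp, fun v hv => ?_⟩
  simp only [of_apply, sum_mul_const_mul, hv]
  simp

theorem PosSemidef.isSymm' (hA : A.PosSemidef) : A.IsSymm := (posSemidef_iff_sum_nonneg.1 hA).1

theorem IsCondNegDef.isSymm (hA : A.IsCondNegDef) : A.IsSymm :=
  (isCondNegDef_iff_sum_nonpos.1 hA).1

theorem IsSymm.of_map (hA : A.IsSymm) (f : ℝ → ℝ) : (of fun i j => f (A i j)).IsSymm := by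
  ext i j
  simp [hA.apply i j]

theorem PosSemidef.of_mul (hA : A.PosSemidef) (hB : B.PosSemidef) :
    (of fun i j => A i j * B i j).PosSemidef :=
  hA.hadamard hB

theorem PosSemidef.of_pow (hA : A.PosSemidef) (k : ℕ) : (of fun i j => A i j ^ k).PosSemidef := by
  induction k with
  | zero => simpa using posSemidef_of_const (m := m) zero_le_one
  | succ k ih => simpa [pow_succ] using ih.of_mul hA

theorem posSemidef_of_tendsto {F : ℕ → Matrix (Fin m) (Fin m) ℝ} (hF : ∀ n, (F n).PosSemidef)
    (h : ∀ i j, Tendsto (fun n => F n i j) atTop (𝓝 (A i j))) : A.PosSemidef := by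
  refine posSemidef_iff_sum_nonneg.2 ⟨?_, fun v => ?_⟩
  · ext i j
    rw [transpose_apply]
    refine tendsto_nhds_unique (h j i) ?_
    simpa only [(hF _).isSymm'.apply j i] using h i j
  · refine ge_of_tendsto' (x := atTop) (f := fun n => ∑ i, ∑ j, v i * F n i j * v j) ?_
      fun n => (posSemidef_iff_sum_nonneg.1 (hF n)).2 v
    exact tendsto_finsetSum _ fun i _ => tendsto_finsetSum _ fun j _ =>
      ((h i j).const_mul _).mul_const _

/-- Partial sums of the exponential series are nonnegative combinations of Schur powers, and
positivity passes to the limit. -/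
theorem PosSemidef.of_exp (hA : A.PosSemidef) : (of fun i j => Real.exp (A i j)).PosSemidef := by
  refine posSemidef_of_tendsto
    (F := fun n => ∑ k ∈ Finset.range n, ((k.factorial : ℝ)⁻¹) • (of fun i j => A i j ^ k))
    (fun n => posSemidef_sum _ fun k _ => (hA.of_pow k).smul (by positivity)) fun i j => ?_
  have h := (NormedSpace.exp_series_hasSum_exp' (𝕂 := ℝ) (A i j)).tendsto_sum_nat
  rw [← Real.exp_eq_exp_ℝ] at h
  simpa [sum_apply] using h

/-- Schoenberg's theorem: the Hadamard exponential of the negative of a conditionally negative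
definite matrix is positive semidefinite. -/
theorem IsCondNegDef.posSemidef_exp_neg (hA : A.IsCondNegDef) :
    (of fun i j => Real.exp (-A i j)).PosSemidef := by
  obtain ⟨hs, hv⟩ := isCondNegDef_iff_sum_nonpos.1 hA
  rcases isEmpty_or_nonempty (Fin m) with hm | ⟨⟨o⟩⟩
  · exact posSemidef_iff_sum_nonneg.2 ⟨by ext i; exact hm.elim i, fun v => by simp⟩
  have hB : (of fun i j => A i o + A o j - A i j - A o o).PosSemidef := by
    refine posSemidef_iff_sum_nonneg.2 ⟨?_, fun v => ?_⟩
    · ext i j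
      simp only [transpose_apply, of_apply, hs.apply i j, hs.apply o j, hs.apply i o]
      ring
    -- Moving the total mass of `v` to the base point `o` makes the coordinates sum to zero.
    · have h := hv (fun i => v i - if i = o then ∑ j, v j else 0) (by simp)
      simp only [sub_mul, mul_sub, Finset.sum_sub_distrib, ite_mul, mul_ite, zero_mul, mul_zero,
        Finset.sum_ite_eq', Finset.mem_univ, if_true, Finset.sum_ite_irrel, Finset.sum_const_zero]
        at h
      simp only [of_apply, sub_mul, mul_sub, add_mul, mul_add, Finset.sum_sub_distrib,
        Finset.sum_add_distrib, sum_mul_const_mul]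
      have h1 : ∑ i, ∑ j, v i * A i o * v j = ∑ i, v i * A i o * ∑ j, v j := by
        simp only [Finset.mul_sum]
      have h2 : ∑ i, ∑ j, v i * A o j * v j = ∑ j, (∑ i, v i) * A o j * v j := by
        rw [Finset.sum_comm]
        simp only [Finset.sum_mul]
      rw [h1, h2]
      linarith
  refine posSemidef_iff_sum_nonneg.2 ⟨hs.of_map fun t => Real.exp (-t), fun v => ?_⟩
  -- `exp(-A i j) = d i * exp(B i j) * d j` with `d i = exp(A o o / 2 - A i o)`, so the factors `d`
  -- are absorbed into `v`.
  have h := (posSemidef_iff_sum_nonneg.1 hB.of_exp).2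
    fun i => v i * Real.exp (A o o / 2 - A i o)
  refine h.trans_eq (Finset.sum_congr rfl fun i _ => Finset.sum_congr rfl fun j _ => ?_)
  have e : -A i j = (A o o / 2 - A i o) + (A i o + A o j - A i j - A o o)
      + (A o o / 2 - A j o) := by rw [hs.apply o j]; ring
  simp only [of_apply]
  rw [e, Real.exp_add, Real.exp_add]
  ring

theorem IsCondNegDef.of_const_add_mul (hA : A.IsCondNegDef) (b : ℝ) {c : ℝ} (hc : 0 ≤ c) :
    (of fun i j => b + c * A i j).IsCondNegDef := by
  refine isCondNegDef_iff_sum_nonpos.2 ⟨hA.isSymm.of_map fun t => b + c * t, fun v hv => ?_⟩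
  have h := (isCondNegDef_iff_sum_nonpos.1 hA).2 v hv
  have e : ∑ i, ∑ j, v i * (of fun i j => b + c * A i j) i j * v j
      = b * (∑ i, v i) ^ 2 + c * ∑ i, ∑ j, v i * A i j * v j := by
    rw [← sum_mul_const_mul, Finset.mul_sum, ← Finset.sum_add_distrib]
    refine Finset.sum_congr rfl fun i _ => ?_
    rw [Finset.mul_sum, ← Finset.sum_add_distrib]
    exact Finset.sum_congr rfl fun j _ => by simp only [of_apply]; ring
  rw [e, hv]
  nlinarith [mul_nonneg hc (neg_nonneg.2 h)]

/-! ### Negative powers through the Gamma integral -/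

open MeasureTheory Set in
/-- The negative Hadamard powers of a conditionally negative definite matrix with positive entries
are positive semidefinite. -/
theorem IsCondNegDef.posSemidef_rpow_neg (hA : A.IsCondNegDef) (hpos : ∀ i j, 0 < A i j) {a : ℝ}
    (ha : 0 ≤ a) : (of fun i j => A i j ^ (-a)).PosSemidef := by
  rcases ha.eq_or_lt with rfl | ha
  · simpa using posSemidef_of_const (m := m) zero_le_one
  refine posSemidef_iff_sum_nonneg.2 ⟨hA.isSymm.of_map fun t => t ^ (-a), fun v => ?_⟩
  have hG := Real.Gamma_pos_of_pos ha
  have key : ∀ i j, ∫ t : ℝ in Ioi 0, t ^ (a - 1) * Real.exp (-(A i j * t))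
      = A i j ^ (-a) * Real.Gamma a := fun i j => by
    rw [Real.integral_rpow_mul_exp_neg_mul_Ioi ha (hpos i j), one_div,
      Real.inv_rpow (hpos i j).le, Real.rpow_neg (hpos i j).le]
  -- The integral of a non-integrable function is `0` by convention, so a nonzero value forces
  -- integrability.
  have hint : ∀ i j, IntegrableOn (fun t : ℝ => t ^ (a - 1) * Real.exp (-(A i j * t))) (Ioi 0) :=
    fun i j => .of_integral_ne_zero <| by
      rw [key]; exact (mul_pos (Real.rpow_pos_of_pos (hpos i j) _) hG).ne'
  have e : (∑ i, ∑ j, v i * (of fun i j => A i j ^ (-a)) i j * v j) * Real.Gamma a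
      = ∫ t : ℝ in Ioi 0, ∑ i, ∑ j, v i * (t ^ (a - 1) * Real.exp (-(A i j * t))) * v j := by
    rw [integral_finsetSum _ fun i _ => integrable_finsetSum _ fun j _ =>
      ((hint i j).const_mul _).mul_const _, Finset.sum_mul]
    refine Finset.sum_congr rfl fun i _ => ?_
    rw [integral_finsetSum _ fun j _ => ((hint i j).const_mul _).mul_const _, Finset.sum_mul]
    refine Finset.sum_congr rfl fun j _ => ?_
    rw [integral_mul_const, integral_const_mul, key, of_apply]
    ring
  refine nonneg_of_mul_nonneg_left (b := Real.Gamma a) ?_ hG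
  rw [e]
  refine setIntegral_nonneg measurableSet_Ioi fun t ht => ?_
  have ht : 0 < t := ht
  have h := (posSemidef_iff_sum_nonneg.1
    ((hA.of_const_add_mul 0 ht.le).posSemidef_exp_neg.smul
      (Real.rpow_nonneg ht.le (a - 1)))).2 v
  refine h.trans_eq (Finset.sum_congr rfl fun i _ => Finset.sum_congr rfl fun j _ => ?_)
  simp [mul_comm t]

/-! ### Functions preserving conditional negative definiteness -/

/-- If `H' (A i j + τ)` is a positive semidefinite matrix for all `τ > 0` and `H'` vanishes at
infinity, then `H (A i j)` is a conditionally negative definite matrix. -/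
theorem isCondNegDef_of_posSemidef_deriv (hs : A.IsSymm) (hpos : ∀ i j, 0 ≤ A i j) {H H' : ℝ → ℝ}
    (hc : ContinuousOn H (Set.Ici 0)) (hd : ∀ t, 0 < t → HasDerivAt H (H' t) t)
    (hlim : Tendsto H' atTop (𝓝 0))
    (hpsd : ∀ τ, 0 < τ → (of fun i j => H' (A i j + τ)).PosSemidef) :
    (of fun i j => H (A i j)).IsCondNegDef := by
  refine isCondNegDef_iff_sum_nonpos.2 ⟨hs.of_map H, fun v hv => ?_⟩
  -- `Φ` is nondecreasing and tends to `0` at infinity, hence `Φ 0 ≤ 0`.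
  set Φ : ℝ → ℝ := fun τ => ∑ i, ∑ j, v i * H (A i j + τ) * v j with hΦ
  have hder : ∀ τ, 0 < τ → HasDerivAt Φ (∑ i, ∑ j, v i * H' (A i j + τ) * v j) τ := fun τ hτ =>
    HasDerivAt.fun_sum fun i _ => HasDerivAt.fun_sum fun j _ =>
      (((hd _ (add_pos_of_nonneg_of_pos (hpos i j) hτ)).comp_const_add (A i j) τ).const_mul
        (v i)).mul_const (v j)
  have hcont : ContinuousOn Φ (Set.Ici 0) :=
    continuousOn_finsetSum _ fun i _ => continuousOn_finsetSum _ fun j _ =>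
      (continuousOn_const.mul (hc.comp (by fun_prop) fun τ hτ =>
        add_nonneg (hpos i j) hτ)).mul continuousOn_const
  have hmono : MonotoneOn Φ (Set.Ici 0) := by
    refine monotoneOn_of_deriv_nonneg (convex_Ici 0) hcont ?_ ?_ <;>
      rw [interior_Ici]
    · exact fun τ hτ => (hder τ hτ).differentiableAt.differentiableWithinAt
    · intro τ hτ
      rw [(hder τ hτ).deriv]
      exact (posSemidef_iff_sum_nonneg.1 (hpsd τ hτ)).2 v
  have hincr : ∀ d, 0 ≤ d → Tendsto (fun τ => H (d + τ) - H τ) atTop (𝓝 0) := by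
    intro d hd0
    rw [Metric.tendsto_atTop]
    intro ε hε
    obtain ⟨N, hN⟩ := (Metric.tendsto_atTop.1 hlim) (ε / (d + 1)) (by positivity)
    refine ⟨max N 1, fun τ hτ => ?_⟩
    have hτ1 : 1 ≤ τ := (le_max_right _ _).trans hτ
    have h := (convex_Icc τ (d + τ)).norm_image_sub_le_of_norm_hasDerivWithin_le
      (f := H) (f' := H') (C := ε / (d + 1)) (x := τ) (y := d + τ)
      (fun t ht => (hd t (by linarith [ht.1])).hasDerivWithinAt)
      (fun t ht => by
        have := hN t (((le_max_left _ _).trans hτ).trans ht.1)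
        rw [dist_zero_right] at this
        exact this.le) ⟨le_rfl, by linarith⟩ ⟨by linarith, le_rfl⟩
    rw [dist_zero_right]
    refine h.trans_lt ?_
    rw [add_sub_cancel_right, Real.norm_of_nonneg hd0, div_mul_eq_mul_div, div_lt_iff₀ (by linarith)]
    nlinarith
  -- As `v` sums to zero, `H τ` may be subtracted from every entry; only vanishing increments
  -- remain.
  have hzero : Tendsto Φ atTop (𝓝 0) := by
    have h : Tendsto (fun τ => ∑ i, ∑ j, v i * (H (A i j + τ) - H τ) * v j) atTop
        (𝓝 (∑ i, ∑ j, v i * 0 * v j)) :=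
      tendsto_finsetSum _ fun i _ => tendsto_finsetSum _ fun j _ =>
        ((hincr _ (hpos i j)).const_mul _).mul_const _
    simp only [mul_zero, zero_mul, Finset.sum_const_zero] at h
    refine h.congr fun τ => ?_
    simp only [mul_sub, sub_mul, Finset.sum_sub_distrib, sum_mul_const_mul, hv, hΦ]
    simp
  have h0 : Φ 0 ≤ 0 := ge_of_tendsto hzero <| (eventually_ge_atTop 0).mono fun τ hτ =>
    hmono Set.self_mem_Ici hτ hτ
  simpa [hΦ] using h0

theorem IsCondNegDef.of_add_const (hA : A.IsCondNegDef) (τ : ℝ) :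
    (of fun i j => A i j + τ).IsCondNegDef := by
  simpa [add_comm] using hA.of_const_add_mul τ zero_le_one

/-- The Hadamard powers with exponent in `[0, 1]` of a conditionally negative definite matrix with
nonnegative entries are conditionally negative definite. -/
theorem IsCondNegDef.of_rpow (hA : A.IsCondNegDef) (hpos : ∀ i j, 0 ≤ A i j) {p : ℝ} (hp0 : 0 ≤ p)
    (hp1 : p ≤ 1) : (of fun i j => A i j ^ p).IsCondNegDef := by
  rcases hp1.eq_or_lt with rfl | hp1
  · convert hA using 1
    ext i j
    simp
  refine isCondNegDef_of_posSemidef_deriv (H := fun t => t ^ p) (H' := fun t => p * t ^ (p - 1))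
    hA.isSymm hpos (Real.continuous_rpow_const hp0).continuousOn
    (fun t ht => Real.hasDerivAt_rpow_const (Or.inl ht.ne')) ?_ fun τ hτ => ?_
  · simpa using (tendsto_rpow_neg_atTop (sub_pos.2 hp1)).const_mul p
  · have h := ((hA.of_add_const τ).posSemidef_rpow_neg
      (fun i j => add_pos_of_nonneg_of_pos (hpos i j) hτ) (sub_nonneg.2 hp1.le)).smul hp0
    convert h using 1
    ext i j
    simp

/-- With `q = 1/r - 1`, the derivative is `c r q` times `t^(-(1-(k+1)r)) * (b t^(-r) + c)^k * (b + c
t^r)^(-(k-(q-1)))` for any natural `k`; each factor is positive semidefinite at `A + τ` when `q - 1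
≤ k` and `(k+1) r ≤ 1`. -/
theorem IsCondNegDef.of_const_add_mul_rpow_rpow (hA : A.IsCondNegDef) (hpos : ∀ i j, 0 ≤ A i j)
    {r : ℝ} (hr0 : 0 < r) (hr1 : r ≤ 1) {b c : ℝ} (hb : 0 ≤ b) (hc : 0 < c) :
    (of fun i j => (b + c * A i j ^ r) ^ (1 / r - 1)).IsCondNegDef := by
  set q := 1 / r - 1 with hq
  have hrq : r * q = 1 - r := by rw [hq]; field_simp
  have hq0 : 0 ≤ q := by nlinarith
  have hbase : ∀ t : ℝ, 0 < t → 0 < b + c * t ^ r := fun t ht => by positivity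
  refine isCondNegDef_of_posSemidef_deriv (H := fun t => (b + c * t ^ r) ^ q)
    (H' := fun t => c * (r * t ^ (r - 1)) * q * (b + c * t ^ r) ^ (q - 1)) hA.isSymm hpos
    ?_ (fun t ht => ?_) ?_ fun τ hτ => ?_
  · exact ((continuous_const.add (continuous_const.mul
      (Real.continuous_rpow_const hr0.le))).rpow_const fun _ => Or.inr hq0).continuousOn
  · exact (((Real.hasDerivAt_rpow_const (Or.inl ht.ne')).const_mul c).const_add b).rpow_const
      (Or.inl (hbase t ht).ne')
  · have h0 := tendsto_rpow_neg_atTop hr0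
    have h1 : Tendsto (fun t : ℝ => b * t ^ (-r) + c) atTop (𝓝 c) := by
      simpa using (h0.const_mul b).add_const c
    have h2 := ((h0.mul (h1.rpow_const (p := q - 1) (Or.inl hc.ne'))).const_mul (c * r * q))
    simp only [zero_mul, mul_zero] at h2
    refine h2.congr' ((eventually_gt_atTop 0).mono fun t ht => ?_)
    have e : b + c * t ^ r = t ^ r * (b * t ^ (-r) + c) := by
      rw [Real.rpow_neg ht.le]
      have := (Real.rpow_pos_of_pos ht r).ne'
      field_simp
    have e2 : t ^ (-r) = t ^ (r - 1) * (t ^ r) ^ (q - 1) := by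
      rw [← Real.rpow_mul ht.le, ← Real.rpow_add ht]
      congr 1
      linarith
    dsimp only
    rw [e, Real.mul_rpow (by positivity) (by positivity)]
    nth_rewrite 1 [e2]
    ring
  -- The least natural `k ≥ q - 1`; if `q ≥ 1` then `k < q`, i.e. `(k + 1) r < 1`, and otherwise `k
  -- = 0`.
  · set k := ⌈q - 1⌉₊ with hk
    have hk1 : q - 1 ≤ k := Nat.le_ceil _
    have hk2 : (k + 1) * r ≤ 1 := by
      rcases le_total (q - 1) 0 with h | h
      · rw [hk, Nat.ceil_eq_zero.2 h]
        simpa using hr1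
      · have := Nat.ceil_lt_add_one h
        nlinarith
    have hAτ := hA.of_add_const τ
    have hpos' : ∀ i j, 0 < (of fun i j => A i j + τ) i j :=
      fun i j => add_pos_of_nonneg_of_pos (hpos i j) hτ
    have P1 := hAτ.posSemidef_rpow_neg hpos' (a := 1 - (k + 1) * r) (by linarith)
    have P2 := (((hAτ.posSemidef_rpow_neg hpos' hr0.le).smul hb).add
      (posSemidef_of_const (m := m) hc.le)).of_pow k
    have P3 := ((hAτ.of_rpow (fun i j => (hpos' i j).le) hr0.le hr1).of_const_add_mul b
      hc.le).posSemidef_rpow_neg (fun i j => hbase _ (hpos' i j)) (a := k - (q - 1)) (by linarith)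
    have P := ((P1.of_mul P2).of_mul P3).smul (show 0 ≤ c * r * q by positivity)
    convert P using 1
    ext i j
    have ht : 0 < A i j + τ := hpos' i j
    simp only [of_apply, smul_apply, add_apply, smul_eq_mul]
    generalize A i j + τ = t at ht
    have e : (b + c * t ^ r) ^ (q - 1)
        = (t ^ r) ^ k * (b * t ^ (-r) + c) ^ k * (b + c * t ^ r) ^ (-(k - (q - 1))) := by
      rw [← mul_pow, mul_add, mul_left_comm, ← Real.rpow_add ht, add_neg_cancel, Real.rpow_zero,
        mul_one, mul_comm (t ^ r) c, ← Real.rpow_natCast, ← Real.rpow_add (hbase t ht)]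
      congr 1
      ring
    have e2 : t ^ (-(1 - (k + 1) * r)) = t ^ (r - 1) * (t ^ r) ^ k := by
      rw [← Real.rpow_natCast, ← Real.rpow_mul ht.le, ← Real.rpow_add ht]
      congr 1
      ring
    rw [e, e2]
    ring

end Matrix

/-! ### The integral representation and the norm quotients -/

/-- The continuous extension to `t = 1` of `t ↦ (1 - t) / (1 - t ^ r)` is a mixture of the functions
`t ↦ (1 - s + s * t ^ r) ^ (1 / r - 1)` with `0 ≤ s ≤ 1`. -/
theorem integral_one_sub_add_mul_rpow {r t : ℝ} (hr0 : 0 < r) (ht : 0 ≤ t) :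
    1 / r * ∫ s in (0 : ℝ)..1, ((1 - s) + s * t ^ r) ^ (1 / r - 1)
      = open Classical in if t = 1 then 1 / r else (1 - t) / (1 - t ^ r) := by
  split_ifs with h
  · simp [h]
  have hr : 1 / r ≠ 0 := by positivity
  have hu0 : 0 ≤ t ^ r := Real.rpow_nonneg ht r
  have hu : t ^ r - 1 ≠ 0 := by
    rw [sub_ne_zero]
    exact fun h' => h ((Real.rpow_left_inj ht zero_le_one hr0.ne').1 (by simpa using h'))
  have e : ∀ s : ℝ, (1 - s) + s * t ^ r = 1 + (t ^ r - 1) * s := fun s => by ring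
  simp only [e]
  rw [intervalIntegral.integral_comp_add_mul (fun x => x ^ (1 / r - 1)) hu,
    integral_rpow (Or.inl (by linarith [one_div_pos.2 hr0]))]
  simp only [mul_one, mul_zero, add_zero, add_sub_cancel, sub_add_cancel, Real.one_rpow,
    smul_eq_mul]
  rw [← Real.rpow_mul ht, mul_one_div_cancel hr0.ne', Real.rpow_one]
  have hu' : 1 - t ^ r ≠ 0 := fun h' => hu (by linarith)
  field_simp
  ring

section NormQuot

variable {r : ℝ}

/-- Reduces continuity across the unit sphere to differentiability of `t ^ r` at `1`. -/
theorem normQuotRecip_eq_dslope {E : Type*} [Norm E] (x : E) :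
    normQuotRecip r x = dslope (fun t : ℝ => t ^ r) 1 ‖x‖ := by
  unfold normQuotRecip
  split_ifs with h
  · rw [h, dslope_same]
    simp
  · rw [dslope_of_ne _ h, slope_def_field, Real.one_rpow, ← neg_sub (1 : ℝ) (‖x‖ ^ r),
      ← neg_sub (1 : ℝ) ‖x‖, neg_div_neg_eq]

theorem normQuotRecip_eq_inv {E : Type*} [Norm E] (x : E) :
    normQuotRecip r x = (normQuot r x)⁻¹ := by
  unfold normQuotRecip normQuot
  split_ifs <;> simp

variable {E : Type*} [NormedAddCommGroup E]

theorem normQuot_pos (hr0 : 0 < r) (x : E) : 0 < normQuot r x := by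
  unfold normQuot
  have hx := norm_nonneg x
  split_ifs with h
  · positivity
  · rcases lt_or_gt_of_ne h with h | h
    · exact div_pos (by linarith) (by linarith [Real.rpow_lt_one hx h hr0])
    · exact div_pos_of_neg_of_neg (by linarith) (by linarith [Real.one_lt_rpow h hr0])

theorem continuous_normQuotRecip (hr0 : 0 < r) : Continuous (normQuotRecip r : E → ℝ) := by
  have h : Continuous (dslope (fun t : ℝ => t ^ r) 1) := by
    refine continuous_iff_continuousAt.2 fun t => ?_
    rcases eq_or_ne t 1 with rfl | ht
    · exact continuousAt_dslope_same.2
        (Real.hasDerivAt_rpow_const (Or.inl one_ne_zero)).differentiableAt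
    · exact (continuousAt_dslope_of_ne ht).2 (Real.continuous_rpow_const hr0.le).continuousAt
  have e : (normQuotRecip r : E → ℝ) = fun x => dslope (fun t : ℝ => t ^ r) 1 ‖x‖ :=
    funext normQuotRecip_eq_dslope
  rw [e]
  exact h.comp continuous_norm

theorem continuous_normQuot (hr0 : 0 < r) : Continuous (normQuot r : E → ℝ) := by
  have e : (normQuot r : E → ℝ) = fun x => (normQuotRecip r x)⁻¹ :=
    funext fun x => by rw [normQuotRecip_eq_inv, inv_inv]
  rw [e]
  refine (continuous_normQuotRecip hr0).inv₀ fun x => ?_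
  rw [normQuotRecip_eq_inv]
  exact (inv_pos.2 (normQuot_pos hr0 x)).ne'

variable [InnerProductSpace ℝ E]

/-- For `∑ v i = 0` the form of squared distances is `-2 ‖∑ v i • x i‖²`; the power `1/2` then gives
distances. -/
theorem isCondNegDef_diffMatrix_norm {m : ℕ} (x : Fin m → E) :
    (diffMatrix (fun y : E => ‖y‖) x).IsCondNegDef := by
  have hsq : (diffMatrix (fun y : E => ‖y‖ ^ 2) x).IsCondNegDef := by
    refine Matrix.isCondNegDef_iff_sum_nonpos.2
      ⟨by ext i j; simp [diffMatrix, norm_sub_rev (x j)], fun v hv => ?_⟩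
    have e : ∑ i, ∑ j, v i * diffMatrix (fun y : E => ‖y‖ ^ 2) x i j * v j
        = -2 * inner ℝ (∑ i, v i • x i) (∑ j, v j • x j) := by
      have h1 : ∀ i, ∑ j, v i * ‖x i‖ ^ 2 * v j = 0 := fun i => by
        rw [← Finset.mul_sum, hv, mul_zero]
      have h2 : ∑ i, ∑ j, v i * ‖x j‖ ^ 2 * v j = 0 := by
        rw [Finset.sum_comm]
        simp only [mul_assoc, ← Finset.sum_mul, hv, zero_mul, Finset.sum_const_zero]
      simp only [diffMatrix, Matrix.of_apply, norm_sub_sq_real, mul_add, mul_sub, add_mul, sub_mul,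
        Finset.sum_add_distrib, Finset.sum_sub_distrib, h1, h2, Finset.sum_const_zero]
      rw [sum_inner]
      simp only [inner_sum, real_inner_smul_left, real_inner_smul_right, Finset.mul_sum, zero_sub,
        add_zero, ← Finset.sum_neg_distrib]
      exact Finset.sum_congr rfl fun i _ => Finset.sum_congr rfl fun j _ => by ring
    rw [e]
    nlinarith [real_inner_self_nonneg (x := ∑ i, v i • x i)]
  have h := hsq.of_rpow (fun i j => sq_nonneg _) (p := 1 / 2) (by norm_num) (by norm_num)
  convert h using 1
  ext i j
  simp only [diffMatrix, Matrix.of_apply]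
  rw [← Real.sqrt_eq_rpow, Real.sqrt_sq (norm_nonneg _)]

theorem isCondNegDef_diffMatrix_normQuot (hr0 : 0 < r) (hr1 : r ≤ 1) {m : ℕ} (x : Fin m → E) :
    (diffMatrix (normQuot r) x).IsCondNegDef := by
  have hN := isCondNegDef_diffMatrix_norm x
  set N := diffMatrix (fun y : E => ‖y‖) x with hNdef
  have hpos : ∀ i j, 0 ≤ N i j := fun i j => norm_nonneg (x i - x j)
  refine Matrix.isCondNegDef_iff_sum_nonpos.2
    ⟨by ext i j; simp [diffMatrix, normQuot, norm_sub_rev (x j)], fun v hv => ?_⟩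
  have hq0 : 0 ≤ 1 / r - 1 := by linarith [one_le_one_div hr0 hr1]
  set F : Fin m → Fin m → ℝ → ℝ := fun i j s => ((1 - s) + s * N i j ^ r) ^ (1 / r - 1) with hF
  have hint : ∀ i j, IntervalIntegrable (fun s => v i * F i j s * v j)
      MeasureTheory.volume 0 1 := fun i j => by
    refine Continuous.intervalIntegrable ?_ _ _
    have : Continuous (F i j) :=
      Continuous.rpow_const (by fun_prop) fun _ => Or.inr hq0
    fun_prop
  have e : ∑ i, ∑ j, v i * diffMatrix (normQuot r) x i j * v j
      = 1 / r * ∫ s in (0 : ℝ)..1, ∑ i, ∑ j, v i * F i j s * v j := by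
    rw [intervalIntegral.integral_finsetSum fun i _ => by
      simpa [Finset.sum_fn] using IntervalIntegrable.sum _ fun j _ => hint i j, Finset.mul_sum]
    refine Finset.sum_congr rfl fun i _ => ?_
    rw [intervalIntegral.integral_finsetSum fun j _ => hint i j, Finset.mul_sum]
    refine Finset.sum_congr rfl fun j _ => ?_
    have h : diffMatrix (normQuot r) x i j = 1 / r * ∫ s in (0 : ℝ)..1, F i j s :=
      (integral_one_sub_add_mul_rpow hr0 (hpos i j)).symm
    rw [intervalIntegral.integral_mul_const, intervalIntegral.integral_const_mul, h]
    ring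
  rw [e]
  refine mul_nonpos_of_nonneg_of_nonpos (by positivity) ?_
  rw [← neg_nonneg, ← intervalIntegral.integral_neg]
  refine intervalIntegral.integral_nonneg zero_le_one fun s hs => neg_nonneg.2 ?_
  have hC : (Matrix.of fun i j => F i j s).IsCondNegDef := by
    -- At `s = 0` the integrand is constant; the general lemma needs a positive coefficient of `t ^
    -- r`.
    rcases hs.1.eq_or_lt with rfl | hs0
    · simpa [hF] using Matrix.isCondNegDef_of_const (m := m) 1
    · exact hN.of_const_add_mul_rpow_rpow hpos hr0 hr1 (sub_nonneg.2 hs.2) hs0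
  exact (Matrix.isCondNegDef_iff_sum_nonpos.1 hC).2 v hv

theorem isInfDivisible_diffMatrix_normQuotRecip (hr0 : 0 < r) (hr1 : r ≤ 1) {m : ℕ}
    (x : Fin m → E) : (diffMatrix (normQuotRecip r) x).IsInfDivisible := by
  refine ⟨fun i j => ?_, fun α hα => ?_⟩
  · simp only [diffMatrix, Matrix.of_apply, normQuotRecip_eq_inv]
    exact (inv_pos.2 (normQuot_pos hr0 _)).le
  · have h := (isCondNegDef_diffMatrix_normQuot hr0 hr1 x).posSemidef_rpow_neg
      (fun i j => normQuot_pos hr0 _) hα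
    convert h using 1
    ext i j
    simp only [Matrix.hadamardPow, diffMatrix, Matrix.of_apply, normQuotRecip_eq_inv]
    rw [Real.inv_rpow (normQuot_pos hr0 _).le, Real.rpow_neg (normQuot_pos hr0 _).le]

end NormQuot

theorem theorem1 (r : ℝ) (hr0 : 0 < r) (hr1 : r ≤ 1) (n : ℕ) :
    IsCondNegDefFun (normQuot r : EuclideanSpace ℝ (Fin n) → ℝ) ∧
      (∀ x : EuclideanSpace ℝ (Fin n), normQuotRecip r x = (normQuot r x)⁻¹) ∧
      IsInfDivisibleFun (normQuotRecip r : EuclideanSpace ℝ (Fin n) → ℝ) :=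
  ⟨⟨continuous_normQuot hr0, fun _ x => isCondNegDef_diffMatrix_normQuot hr0 hr1 x⟩,
    normQuotRecip_eq_inv,
    continuous_normQuotRecip hr0, fun _ x => isInfDivisible_diffMatrix_normQuotRecip hr0 hr1 x⟩
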